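/- **Definition.** Let $F$ be a complete field with a norm $|\cdot|$, $X$ a metric space, $\mu$ a Borel measure on $X$, $U\subseteq X$, and $C,\alpha>0$. A continuous function $f:U\to F$ is $(C,\alpha)$-good on $U$ with respect to $\mu$ if for every open ball $B\subseteq U$ of $X$ centered in $\operatorname{supp}\mu$ and every $\epsilon>0$, $$\mu(\{x\in B:|f(x)|<\epsilon\})\le C\left(\frac{\epsilon}{\|f\|_{\mu,B}}\right)^{\alpha}\mu(B),\qquad \|f\|_{\mu,B}=\sup\{|f(x)|:x\in B\cap\operatorname{supp}\mu\},$$ where the right-hand side is $+\infty$ if $\|f\|_{\mu,B}=0$. **Proposition.** Let $n\in\mathbb N$. 1. (Archimedean case.) There exist $C,\alpha>0$ depending only on $n$ such that for every $\Lambda>0$ there is $\delta_0>0$ with the following property: for all $c_{i,l}\in\mathbb C$, all $\lambda_i\in\mathbb C$ with $|\lambda_i|\le\Lambda$ $(1\le i\le n,\ 0\le l\le n-1)$, and every interval $I\subset\mathbb R$ of length at most $\delta_0$, the function $$f(s)=\sum_{i=1}^n\sum_{l=0}^{n-1}c_{i,l}\,s^l e^{\lambda_i s},\qquad s\in I,$$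 is $(C,\alpha)$-good on $I$ with respect to Lebesgue measure on $\mathbb R$. 2. (Non-Archimedean case.) Let $p$ be a prime, let $F$ be a finite extension of $\mathbb Q_p$ with the norm extending $|\cdot|_p$, and let $\mathcal O_F=\{x\in F:|x|\le1\}$. There exist $k\in\mathbb N$ and $C,\alpha>0$, depending only on $F$ and $n$, such that the exponential series of $\lambda s$ converges for all $\lambda\in p^k\mathcal O_F$ and $s\in\mathbb Z_p$, and for all $c_{i,l}\in F$ and all distinct $\lambda_1,\dots,\lambda_n\in p^k\mathcal O_F$, the function $$f(s)=\sum_{i=1}^n\sum_{l=0}^{n-1}c_{i,l}\,s^l e^{\lambda_i s},\qquad s\in\mathbb Z_p,$$ is $(C,\alpha)$-good on $\mathbb Z_p$ with respect to the Haar measure $\mu$ on $\mathbb Q_p$ normalized by $\mu(\mathbb Z_p)=1$. -/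

import Mathlib

open MeasureTheory
open scoped ENNReal

/-- `‖f‖_{μ,B} = sup {|f x| : x ∈ B ∩ supp μ}`, as an extended nonnegative real. -/
noncomputable def supNormOn {X F : Type*} [PseudoMetricSpace X] [MeasurableSpace X]
    [NormedField F] (μ : Measure X) (B : Set X) (f : X → F) : ℝ≥0∞ :=
  ⨆ x ∈ B ∩ μ.support, ‖f x‖ₑ

/-- `f` is `(C, α)`-good on `U` with respect to `μ`. Only the values of `f` on `U` matter. The
inequality is read in `[0, ∞]`, so it is no condition on a ball on which `f` vanishes
(`ε / 0 = ∞`). -/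
def IsGoodOn {X F : Type*} [PseudoMetricSpace X] [MeasurableSpace X] [NormedField F]
    (C α : ℝ) (μ : Measure X) (U : Set X) (f : X → F) : Prop :=
  ContinuousOn f U ∧
    ∀ x ∈ μ.support, ∀ r > 0, Metric.ball x r ⊆ U → ∀ ε : ℝ, 0 < ε →
      μ {y ∈ Metric.ball x r | ‖f y‖ < ε} ≤
        ENNReal.ofReal C * (ENNReal.ofReal ε / supNormOn μ (Metric.ball x r) f) ^ α *
          μ (Metric.ball x r)

/-- The exponential polynomial `∑_{i=1}^{n} ∑_{l=0}^{n-1} c_{i,l} s^l e^{λ_i s}`. -/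
noncomputable def expPoly {K : Type*} [NormedField K] {n : ℕ} (c : Fin n → Fin n → K)
    (lam : Fin n → K) (s : K) : K :=
  ∑ i : Fin n, ∑ l : Fin n, c i l * s ^ (l : ℕ) * NormedSpace.exp (lam i * s)

/-- The set `p^k O_F`, where `O_F = {x ∈ F : |x| ≤ 1}`. -/
def primePowIntegers (F : Type*) [NormedField F] (p k : ℕ) : Set F :=
  {x | ∃ y : F, ‖y‖ ≤ 1 ∧ x = (p : F) ^ k * y}

/-!
After rescaling a ball to the unit ball, an exponential polynomial with small frequencies is a power
series whose coefficients, multiplied by `m!`, satisfy a linear recurrence of order `N = n ^ 2` with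
small characteristic roots. Hence its coefficients from the index `N` on are dominated by the first
`N` ones. Like a polynomial of degree less than `N`, such a series is controlled on the unit ball by
its values at any `N` points at mutual distance at least `d`, with a loss of `d ^ (-N)`: divide out
the points one at a time, the quotients `(f x - f v) / (x - v)` being of the same kind. Finally, a
set of measure proportional to `d` inside the ball contains `N` such points, since it cannot be
covered by `N` balls of radius `d`; for a sublevel set of `f` this is the required bound.
-/

section PowerSum

variable {K : Type*} [NormedField K] {N : ℕ} {B d ε : ℝ} {a : ℕ → K} {v x : K}

/-- The value at `x` of the power series with coefficients `a`; it is `0` where the series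
diverges. -/
noncomputable def powerSum (a : ℕ → K) (x : K) : K :=
  ∑' m, a m * x ^ m

/-- From the index `N` on, the coefficients `a` decay geometrically. The rate `1 / 3` makes the
power series converge on the closed unit ball, and is small enough for one synthetic division
to halve the constant `B`. -/
def HasGeometricTail (N : ℕ) (B : ℝ) (a : ℕ → K) : Prop :=
  ∀ m ≥ N, ‖a m‖ ≤ B / 3 ^ m

/-- The coefficients of the quotient `(f x - f v) / (x - v)`, where `f = powerSum a`. -/
noncomputable def divCoeff (a : ℕ → K) (v : K) (i : ℕ) : K :=
  powerSum (fun m => a (i + 1 + m)) v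

/-- The coefficients of `a` from the index `N` on are controlled by the first `N` ones: they decay
geometrically, with constant half of any bound for the first `N`. -/
def HasDominatedTail (N : ℕ) (a : ℕ → K) : Prop :=
  ∀ A, 0 ≤ A → (∀ j < N, ‖a j‖ ≤ A) → HasGeometricTail N (A / 2) a

theorem hasSum_div_three_pow (B : ℝ) : HasSum (fun m : ℕ => B / 3 ^ m) (3 / 2 * B) := by
  have h := (hasSum_geometric_of_lt_one (r := (3 : ℝ)⁻¹) (by norm_num) (by norm_num)).mul_left B
  rw [show B * (1 - (3 : ℝ)⁻¹)⁻¹ = 3 / 2 * B by ring] at h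
  simpa only [inv_pow, ← div_eq_mul_inv] using h

theorem geom_sum_le_pow {r : ℝ} (hr : 2 ≤ r) (N : ℕ) : ∑ i ∈ Finset.range N, r ^ i ≤ r ^ N := by
  rw [geom_sum_eq (by linarith)]
  refine (div_le_self ?_ (by linarith)).trans (sub_le_self _ zero_le_one)
  exact sub_nonneg.2 (one_le_pow₀ (by linarith))

theorem norm_powerSum_le (ha : HasGeometricTail 0 B a) (hx : ‖x‖ ≤ 1) :
    ‖powerSum a x‖ ≤ 3 / 2 * B := by
  refine tsum_of_norm_bounded (hasSum_div_three_pow B) fun m => ?_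
  rw [norm_mul, norm_pow]
  exact (mul_le_of_le_one_right (norm_nonneg _) (pow_le_one₀ (norm_nonneg _) hx)).trans
    (ha m m.zero_le)

theorem HasGeometricTail.divCoeff (ha : HasGeometricTail (N + 1) B a) (hv : ‖v‖ ≤ 1) :
    HasGeometricTail N (B / 2) (divCoeff a v) := by
  intro i hi
  have hshift : HasGeometricTail 0 (B / 3 ^ (i + 1)) fun m => a (i + 1 + m) := fun m _ => by
    rw [div_div, ← pow_add]
    exact ha _ (by lia)
  calc ‖powerSum (fun m => a (i + 1 + m)) v‖ ≤ 3 / 2 * (B / 3 ^ (i + 1)) :=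
        norm_powerSum_le hshift hv
    _ = B / 2 / 3 ^ i := by
        rw [pow_succ]
        field_simp

theorem HasDominatedTail.hasGeometricTail_zero {A : ℝ} (ha : HasDominatedTail N a) (hA : 0 ≤ A)
    (h : ∀ j < N, ‖a j‖ ≤ A) : HasGeometricTail 0 (3 ^ N * A) a := by
  intro m _
  rcases lt_or_ge m N with hm | hm
  · rw [le_div_iff₀ (by positivity), mul_comm]
    gcongr
    · norm_num
    · exact h m hm
  · refine (ha A hA h m hm).trans ?_
    gcongr
    have : (1 : ℝ) ≤ 3 ^ N := one_le_pow₀ (by norm_num)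
    nlinarith

theorem powerSum_eq_zero_add (ha : Summable fun m => a m * x ^ m) :
    powerSum a x = a 0 + x * powerSum (fun m => a (m + 1)) x := by
  simp only [powerSum, ha.tsum_eq_zero_add, pow_zero, mul_one, ← tsum_mul_left]
  congr! 3
  ring

variable [CompleteSpace K]

theorem HasGeometricTail.summable (ha : HasGeometricTail N B a) (hx : ‖x‖ ≤ 1) :
    Summable fun m => a m * x ^ m := by
  refine .of_norm_bounded_eventually_nat (hasSum_div_three_pow B).summable ?_
  filter_upwards [Filter.eventually_ge_atTop N] with m hm
  rw [norm_mul, norm_pow]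
  exact (mul_le_of_le_one_right (norm_nonneg _) (pow_le_one₀ (norm_nonneg _) hx)).trans (ha m hm)

theorem powerSum_eq_add_divCoeff (ha : HasGeometricTail N B a) (hv : ‖v‖ ≤ 1) :
    powerSum a v = a 0 + v * divCoeff a v 0 := by
  simp only [powerSum_eq_zero_add (ha.summable hv), divCoeff, zero_add, add_comm]

theorem divCoeff_eq_add (ha : HasGeometricTail N B a) (hv : ‖v‖ ≤ 1) (i : ℕ) :
    divCoeff a v i = a (i + 1) + v * divCoeff a v (i + 1) := by
  have hshift : HasGeometricTail N (B / 3 ^ (i + 1)) fun m => a (i + 1 + m) := fun m hm => by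
    rw [div_div, ← pow_add]
    exact ha _ (by lia)
  rw [divCoeff, powerSum_eq_zero_add (hshift.summable hv)]
  simp only [divCoeff, add_zero, add_assoc, add_comm 1]

theorem powerSum_sub_powerSum (ha : HasGeometricTail (N + 1) B a) (hv : ‖v‖ ≤ 1) (hx : ‖x‖ ≤ 1) :
    powerSum a x - powerSum a v = (x - v) * powerSum (divCoeff a v) x := by
  set b := divCoeff a v
  have hb : Summable fun m => b m * x ^ m := (ha.divCoeff hv).summable hx
  have ha' : Summable fun m => a (m + 1) * x ^ m := by
    have hshift : HasGeometricTail N (B / 3) fun m => a (m + 1) := fun m hm => by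
      rw [div_div, ← pow_succ']
      exact ha _ (by lia)
    exact hshift.summable hx
  have hmul :
      v * powerSum b x = v * b 0 + x * (powerSum b x - powerSum (fun m => a (m + 1)) x) := by
    have hrec (m : ℕ) : v * b (m + 1) = b m - a (m + 1) :=
      eq_sub_of_add_eq' (divCoeff_eq_add ha hv m).symm
    calc v * powerSum b x = powerSum (fun m => v * b m) x := by
          simp only [powerSum, ← tsum_mul_left, mul_assoc]
      _ = v * b 0 + x * powerSum (fun m => b m - a (m + 1)) x := by
          rw [powerSum_eq_zero_add (by simpa only [mul_assoc] using hb.mul_left v)]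
          simp only [hrec]
      _ = _ := by simp only [powerSum, sub_mul, hb.tsum_sub ha']
  rw [powerSum_eq_zero_add (ha.summable hx), powerSum_eq_add_divCoeff ha hv, sub_mul, hmul]
  ring

theorem norm_coeff_le_of_separated (hd : 0 < d) {v : Fin N → K}
    (hv : ∀ i, ‖v i‖ ≤ 1) (hsep : Pairwise fun i j => d ≤ ‖v i - v j‖)
    (ha : HasGeometricTail N B a) (hf : ∀ i, ‖powerSum a (v i)‖ ≤ ε) (j : ℕ) :
    ‖a j‖ ≤ ε * ∑ i ∈ Finset.range N, (4 / d) ^ i + B := by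
  induction N generalizing a B ε j with
  | zero =>
    have hB : 0 ≤ B := by simpa using (norm_nonneg _).trans (ha 0 le_rfl)
    simpa using (ha j j.zero_le).trans (div_le_self hB (one_le_pow₀ (by norm_num)))
  | succ N ih =>
    set b := divCoeff a (v 0)
    have hquot (i : Fin N) : ‖powerSum b (v i.succ)‖ ≤ 2 * ε / d := by
      rw [le_div_iff₀' hd]
      calc d * ‖powerSum b (v i.succ)‖ ≤ ‖v i.succ - v 0‖ * ‖powerSum b (v i.succ)‖ := by
            gcongr
            exact hsep i.succ_ne_zero
        _ = ‖powerSum a (v i.succ) - powerSum a (v 0)‖ := by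
            rw [← norm_mul, powerSum_sub_powerSum ha (hv 0) (hv _)]
        _ ≤ 2 * ε := by linarith [norm_sub_le_of_le (hf i.succ) (hf 0)]
    set β := 2 * ε / d * ∑ i ∈ Finset.range N, (4 / d) ^ i + B / 2 with hβ
    have hb (j : ℕ) : ‖b j‖ ≤ β :=
      ih (fun i => hv _) (fun i j hij => hsep ((Fin.succ_injective N).ne hij))
        (ha.divCoeff (hv 0)) hquot j
    have hvb (j : ℕ) : ‖v 0 * b j‖ ≤ β := by
      rw [norm_mul]
      exact (mul_le_of_le_one_left (norm_nonneg _) (hv 0)).trans (hb j)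
    have hε : 0 ≤ ε := (norm_nonneg _).trans (hf 0)
    have hβ0 : 0 ≤ β := (norm_nonneg _).trans (hb 0)
    have hsum : ε * ∑ i ∈ Finset.range (N + 1), (4 / d) ^ i + B = ε + 2 * β := by
      rw [geom_sum_succ, hβ]
      ring
    rw [hsum]
    cases j with
    | zero =>
      rw [eq_sub_of_add_eq (powerSum_eq_add_divCoeff ha (hv 0)).symm]
      linarith [norm_sub_le_of_le (hf 0) (hvb 0)]
    | succ j =>
      rw [eq_sub_of_add_eq (divCoeff_eq_add ha (hv 0) j).symm]
      linarith [norm_sub_le_of_le (hb j) (hvb (j + 1))]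

theorem HasDominatedTail.norm_powerSum_le (ha : HasDominatedTail N a) (hd : 0 < d) (hd1 : d ≤ 1)
    (hε : 0 ≤ ε) {v : Fin N → K} (hv : ∀ i, ‖v i‖ ≤ 1)
    (hsep : Pairwise fun i j => d ≤ ‖v i - v j‖) (hf : ∀ i, ‖powerSum a (v i)‖ ≤ ε)
    (hx : ‖x‖ ≤ 1) : ‖powerSum a x‖ ≤ 3 * 12 ^ N * ε / d ^ N := by
  set A : NNReal := (Finset.range N).sup fun j => ‖a j‖₊
  have hA (j : ℕ) (hj : j < N) : ‖a j‖ ≤ A :=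
    NNReal.coe_le_coe.2 (Finset.le_sup (f := fun j => ‖a j‖₊) (Finset.mem_range.2 hj))
  set S := ∑ i ∈ Finset.range N, (4 / d) ^ i with hS
  -- The summand `A / 2` in the bound for the coefficients is absorbed by the left-hand side.
  have hAS : A ≤ 2 * (ε * S) := by
    have hcoeff := norm_coeff_le_of_separated hd hv hsep (ha A A.coe_nonneg hA) hf
    have hle : A ≤ (ε * S + A / 2).toNNReal :=
      Finset.sup_le fun j _ => NNReal.coe_le_coe.1 ((hcoeff j).trans (Real.le_coe_toNNReal _))
    have hAle : (A : ℝ) ≤ ε * S + A / 2 :=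
      (Real.le_toNNReal_iff_coe_le (by positivity)).1 hle
    linarith
  have h4d : 2 ≤ 4 / d := by
    rw [le_div_iff₀ hd]
    linarith
  calc ‖powerSum a x‖ ≤ 3 / 2 * (3 ^ N * A) :=
        _root_.norm_powerSum_le (ha.hasGeometricTail_zero A.coe_nonneg hA) hx
    _ ≤ 3 / 2 * (3 ^ N * (2 * (ε * (4 / d) ^ N))) := by
        grw [hAS, hS, geom_sum_le_pow h4d]
    _ = 3 * 12 ^ N * ε / d ^ N := by
        rw [show (12 : ℝ) = 3 * 4 by norm_num, mul_pow, div_pow]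
        ring

end PowerSum

section LinearRecurrence

open Polynomial

section CommRing

variable {R : Type*}

/-- The characteristic roots, with multiplicity, of the linear recurrence satisfied by the
derivatives at `0` of `expPoly c μ`. -/
def charRoots (n : ℕ) (μ : Fin n → R) : Multiset R :=
  ∑ i, Multiset.replicate n (μ i)

theorem card_charRoots (n : ℕ) (μ : Fin n → R) : (charRoots n μ).card = n * n := by
  simp [charRoots]

theorem mem_range_of_mem_charRoots {n : ℕ} {μ : Fin n → R} {z : R} (hz : z ∈ charRoots n μ) :
    ∃ i, μ i = z := by
  obtain ⟨i, -, hi⟩ := Multiset.mem_sum.1 hz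
  exact ⟨i, (Multiset.eq_of_mem_replicate hi).symm⟩

variable [CommRing R]

/-- The shift operator `β ↦ (m ↦ β (m + 1))` on sequences. A polynomial in it, applied to `β`, is
the corresponding linear recurrence expression. -/
def seqShift (R : Type*) [CommRing R] : Module.End R (ℕ → R) :=
  LinearMap.funLeft R R Nat.succ

/-- The `m`-th derivative at `0` of `x ^ l * exp (μ * x)`. -/
def monomialExpDeriv (μ : R) (l m : ℕ) : R :=
  m.descFactorial l * μ ^ (m - l)

/-- The sequence of derivatives at `0` of the exponential polynomial `expPoly c μ`. -/
def expPolyDeriv {n : ℕ} (c : Fin n → Fin n → R) (μ : Fin n → R) : ℕ → R :=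
  ∑ i, ∑ l : Fin n, c i l • monomialExpDeriv (μ i) l

theorem aeval_seqShift_X_sub_C (z : R) (β : ℕ → R) (m : ℕ) :
    aeval (seqShift R) (X - C z) β m = β (m + 1) - z * β m := by
  simp [seqShift]

theorem aeval_seqShift_monomialExpDeriv_zero (μ : R) :
    aeval (seqShift R) (X - C μ) (monomialExpDeriv μ 0) = 0 := by
  ext m
  rw [aeval_seqShift_X_sub_C]
  simp [monomialExpDeriv, pow_succ']

theorem aeval_seqShift_monomialExpDeriv_succ (μ : R) (l : ℕ) :
    aeval (seqShift R) (X - C μ) (monomialExpDeriv μ (l + 1)) =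
      (l + 1 : R) • monomialExpDeriv μ l := by
  ext m
  simp only [aeval_seqShift_X_sub_C, monomialExpDeriv, Pi.smul_apply, smul_eq_mul,
    Nat.succ_descFactorial_succ, Nat.add_sub_add_right]
  rcases lt_trichotomy m l with h | rfl | h
  · simp [Nat.descFactorial_of_lt h]
  · simp
  · obtain ⟨k, rfl⟩ := Nat.exists_eq_add_of_lt h
    rw [Nat.descFactorial_succ, show l + k + 1 - l = k + 1 by lia,
      show l + k + 1 - (l + 1) = k by lia]
    push_cast
    ring

theorem aeval_seqShift_pow_monomialExpDeriv (μ : R) {l n : ℕ} (hl : l < n) :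
    aeval (seqShift R) ((X - C μ) ^ n) (monomialExpDeriv μ l) = 0 := by
  induction l generalizing n with
  | zero =>
    obtain ⟨n, rfl⟩ := Nat.exists_eq_succ_of_ne_zero hl.ne'
    rw [pow_succ, map_mul, Module.End.mul_apply, aeval_seqShift_monomialExpDeriv_zero, map_zero]
  | succ l ih =>
    obtain ⟨n, rfl⟩ := Nat.exists_eq_succ_of_ne_zero (l.succ_pos.trans hl).ne'
    rw [pow_succ, map_mul, Module.End.mul_apply, aeval_seqShift_monomialExpDeriv_succ, map_smul,
      ih (Nat.lt_of_succ_lt_succ hl), smul_zero]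

theorem aeval_seqShift_expPolyDeriv {n : ℕ} (c : Fin n → Fin n → R) (μ : Fin n → R) :
    aeval (seqShift R) ((charRoots n μ).map fun z => X - C z).prod (expPolyDeriv c μ) = 0 := by
  rw [expPolyDeriv]
  simp only [map_sum, map_smul]
  refine Finset.sum_eq_zero fun i _ => Finset.sum_eq_zero fun l _ => ?_
  have hle : Multiset.replicate n (μ i) ≤ charRoots n μ :=
    Finset.single_le_sum (f := fun i => Multiset.replicate n (μ i)) (fun _ _ => Multiset.zero_le _)
      (Finset.mem_univ i)
  obtain ⟨q, hq⟩ : (X - C (μ i)) ^ n ∣ ((charRoots n μ).map fun z => X - C z).prod := by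
    simpa only [Multiset.map_replicate, Multiset.prod_replicate] using
      Multiset.prod_dvd_prod_of_le (Multiset.map_le_map (f := fun z => X - C z) hle)
  rw [hq, mul_comm, map_mul, Module.End.mul_apply, aeval_seqShift_pow_monomialExpDeriv _ l.2,
    map_zero, smul_zero]

end CommRing

variable {K : Type*} [NormedField K]

theorem norm_le_of_norm_succ_sub_mul_le {β : ℕ → K} {z : K} {N : ℕ} {η A : ℝ}
    (hz : ‖z‖ ≤ η) (hA : ∀ j ≤ N, ‖β j‖ ≤ A)
    (hrec : ∀ m ≥ N, ‖β (m + 1) - z * β m‖ ≤ η ^ (m + 1 - N) * (2 * A)) (m : ℕ) :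
    ‖β m‖ ≤ (4 * η) ^ (m - N) * A := by
  have hη : 0 ≤ η := (norm_nonneg z).trans hz
  have hA0 : 0 ≤ A := (norm_nonneg _).trans (hA 0 N.zero_le)
  rcases le_total m N with hm | hm
  · simpa [Nat.sub_eq_zero_of_le hm] using hA m hm
  · obtain ⟨k, rfl⟩ := Nat.exists_eq_add_of_le hm
    rw [Nat.add_sub_cancel_left]
    clear hm
    induction k with
    | zero => simpa using hA N le_rfl
    | succ k ih =>
      have hk : η ^ k ≤ (4 * η) ^ k := by
        gcongr
        linarith
      have hstep := hrec (N + k) (N.le_add_right k)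
      rw [show N + k + 1 - N = k + 1 by lia, pow_succ'] at hstep
      calc ‖β (N + k + 1)‖ = ‖(β (N + k + 1) - z * β (N + k)) + z * β (N + k)‖ := by
            rw [sub_add_cancel]
        _ ≤ η * (4 * η) ^ k * (2 * A) + η * ((4 * η) ^ k * A) := by
            grw [norm_add_le, norm_mul, hstep, hz, ih, hk]
        _ ≤ (4 * η) ^ (k + 1) * A := by
            rw [pow_succ']
            have : 0 ≤ η * (4 * η) ^ k * A := by positivity
            linarith

theorem norm_le_of_aeval_seqShift_eq_zero {s : Multiset K} {η A : ℝ} (hη : 0 ≤ η)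
    (hs : ∀ z ∈ s, ‖z‖ ≤ η) (hη1 : 4 ^ s.card * η ≤ 1) {β : ℕ → K}
    (hβ : aeval (seqShift K) (s.map fun z => X - C z).prod β = 0) (hA0 : 0 ≤ A)
    (hA : ∀ j < s.card, ‖β j‖ ≤ A) (m : ℕ) :
    ‖β m‖ ≤ (4 ^ s.card * η) ^ (m + 1 - s.card) * A := by
  induction s using Multiset.induction generalizing β A m with
  | empty =>
    obtain rfl : β = 0 := by simpa using hβ
    simp only [Pi.zero_apply, norm_zero]
    positivity
  | cons z s ih =>
    set τ := 4 ^ s.card * η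
    rw [Multiset.card_cons] at *
    rw [pow_succ', mul_assoc] at hη1 ⊢
    obtain ⟨hzη, hsη⟩ := Multiset.forall_mem_cons.1 hs
    have hzτ : ‖z‖ ≤ τ := hzη.trans (le_mul_of_one_le_left hη (one_le_pow₀ (by norm_num)))
    set γ := aeval (seqShift K) (X - C z) β with hγ
    have hγ0 : aeval (seqShift K) (s.map fun z => X - C z).prod γ = 0 := by
      rw [hγ, ← Module.End.mul_apply, ← map_mul, mul_comm]
      simpa using hβ
    have hγA (j : ℕ) (hj : j < s.card) : ‖γ j‖ ≤ 2 * A := by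
      rw [hγ, aeval_seqShift_X_sub_C, two_mul]
      refine norm_sub_le_of_le (hA _ (by lia)) ?_
      rw [norm_mul]
      exact (mul_le_of_le_one_left (norm_nonneg _) (hzτ.trans (by linarith))).trans
        (hA j (by lia))
    rw [Nat.add_sub_add_right]
    refine norm_le_of_norm_succ_sub_mul_le hzτ (fun j hj => hA j (by lia)) (fun m _ => ?_) m
    rw [← aeval_seqShift_X_sub_C]
    exact ih hsη (by linarith) hγ0 (by positivity) hγA m

end LinearRecurrence

section ExpPoly

open Metric NormedSpace
open scoped Nat

/-- The growth condition `‖1 / m!‖ ≤ M ^ m`, which holds with `M = 1` over `ℝ` and with `M = p` over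
`ℚ_[p]`. -/
def FactorialInvBound (K : Type*) [NormedField K] (M : ℝ) : Prop :=
  ∀ m : ℕ, ‖(m ! : K)⁻¹‖ ≤ M ^ m

/-- A bound for the characteristic roots of a linear recurrence of order `N` which ensures that a
power series whose coefficients, multiplied by `m!`, satisfy the recurrence has a dominated tail. -/
noncomputable def frequencyRadius (N : ℕ) (M : ℝ) : ℝ :=
  1 / (4 ^ N * (2 * N ! * (3 * M) ^ (N + 1)))

variable {𝕜 K : Type*} [NontriviallyNormedField 𝕜] [NormedField K] {n N : ℕ} {M : ℝ}

theorem FactorialInvBound.one_le (hM : FactorialInvBound K M) : 1 ≤ M := by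
  simpa using hM 1

theorem FactorialInvBound.of_algebra [NormedAlgebra 𝕜 K] (hM : FactorialInvBound 𝕜 M) :
    FactorialInvBound K M := fun m => by
  simpa only [map_inv₀, map_natCast, norm_algebraMap'] using
    (norm_algebraMap' K (m ! : 𝕜)⁻¹).trans_le (hM m)

theorem FactorialInvBound.mem_eball_radius_expSeries [NormedAlgebra 𝕜 K]
    (hM : FactorialInvBound 𝕜 M) {x : K} (hx : ‖x‖ * M < 1) :
    x ∈ eball (0 : K) (expSeries 𝕜 K).radius := by
  have hM0 : 0 < M := zero_lt_one.trans_le hM.one_le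
  have hradius : ENNReal.ofReal M⁻¹ ≤ (expSeries 𝕜 K).radius := by
    refine FormalMultilinearSeries.le_radius_of_bound _ 1 fun m => ?_
    rw [Real.coe_toNNReal _ (by positivity), expSeries, norm_smul,
      ContinuousMultilinearMap.norm_mkPiAlgebraFin, mul_one, inv_pow]
    exact mul_inv_le_one_of_le₀ (hM m) (by positivity)
  rw [mem_eball, edist_zero_right, ← ofReal_norm]
  refine lt_of_lt_of_le ?_ hradius
  rwa [ENNReal.ofReal_lt_ofReal_iff (by positivity), ← one_div, lt_div_iff₀ hM0]

theorem frequencyRadius_pos (N : ℕ) (hM : 1 ≤ M) : 0 < frequencyRadius N M := by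
  unfold frequencyRadius
  positivity

theorem four_pow_mul_frequencyRadius (N : ℕ) (M : ℝ) :
    4 ^ N * frequencyRadius N M = 1 / (2 * N ! * (3 * M) ^ (N + 1)) := by
  unfold frequencyRadius
  field_simp

theorem four_pow_mul_frequencyRadius_le (N : ℕ) (hM : 1 ≤ M) :
    4 ^ N * frequencyRadius N M * (3 * M) ≤ 1 := by
  rw [four_pow_mul_frequencyRadius, pow_succ, div_mul_eq_mul_div, one_mul,
    div_le_one (by positivity), ← mul_assoc]
  have hfac : (1 : ℝ) ≤ N ! := by exact_mod_cast N.factorial_pos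
  have hpow : 1 ≤ (3 * M) ^ N := one_le_pow₀ (by linarith)
  exact le_mul_of_one_le_left (by positivity)
    (one_le_mul_of_one_le_of_one_le (by linarith) hpow)

theorem frequencyRadius_mul_lt_one (N : ℕ) (hM : 1 ≤ M) : frequencyRadius N M * M < 1 := by
  have h4 : (1 : ℝ) ≤ 4 ^ N := one_le_pow₀ (by norm_num)
  have := four_pow_mul_frequencyRadius_le N hM
  have := frequencyRadius_pos N hM
  nlinarith

theorem hasDominatedTail_div_factorial [CharZero K] {s : Multiset K} (hM : FactorialInvBound K M)
    (hs : ∀ z ∈ s, ‖z‖ ≤ frequencyRadius s.card M) {β : ℕ → K}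
    (hβ : Polynomial.aeval (seqShift K)
      (s.map fun z => Polynomial.X - Polynomial.C z).prod β = 0) :
    HasDominatedTail s.card fun m => β m / m ! := by
  intro A hA0 hA m hm
  set N := s.card
  set θ := 4 ^ N * frequencyRadius N M with hθ
  have hM1 := hM.one_le
  have hη := frequencyRadius_pos N hM1
  have hθM : θ * (3 * M) ≤ 1 := four_pow_mul_frequencyRadius_le N hM1
  have hθ0 : 0 < θ := by positivity
  have hβA (j : ℕ) (hj : j < N) : ‖β j‖ ≤ N ! * A := by
    have hfac : ‖(j ! : K)‖ ≤ N ! := by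
      refine (Nat.norm_cast_le _).trans ?_
      rw [norm_one, mul_one]
      exact_mod_cast Nat.factorial_le hj.le
    calc ‖β j‖ = ‖(j ! : K)‖ * ‖β j / (j ! : K)‖ := by
          rw [← norm_mul, mul_div_cancel₀ _ (by exact_mod_cast j.factorial_ne_zero)]
      _ ≤ N ! * A := by
          gcongr
          exact hA j hj
  have hdecay := norm_le_of_aeval_seqShift_eq_zero hη.le hs (by nlinarith) hβ (by positivity) hβA m
  obtain ⟨k, rfl⟩ := Nat.exists_eq_add_of_le hm
  rw [show N + k + 1 - N = k + 1 by lia] at hdecay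
  calc ‖β (N + k) / (N + k)!‖ ≤ θ ^ (k + 1) * (N ! * A) * M ^ (N + k) := by
        rw [div_eq_mul_inv, norm_mul]
        gcongr
        exact hM _
    _ = (θ * (3 * M)) ^ k * (θ * (N ! * (3 * M) ^ N)) * A / 3 ^ (N + k) := by
        simp only [mul_pow, pow_add, pow_one]
        field_simp
    _ ≤ 1 * (1 / 2) * A / 3 ^ (N + k) := by
        gcongr
        · exact pow_le_one₀ (by positivity) hθM
        · rw [hθ, four_pow_mul_frequencyRadius, pow_succ]
          field_simp
          linarith
    _ = A / 2 / 3 ^ (N + k) := by ring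

/-- The Taylor coefficients at `0` of the exponential polynomial `expPoly c μ`. -/
noncomputable def expPolyTaylor (c : Fin n → Fin n → K) (μ : Fin n → K) (m : ℕ) : K :=
  expPolyDeriv c μ m / m !

theorem hasDominatedTail_expPolyTaylor [CharZero K] (hM : FactorialInvBound K M)
    (c : Fin n → Fin n → K) {μ : Fin n → K} (hμ : ∀ i, ‖μ i‖ ≤ frequencyRadius (n * n) M) :
    HasDominatedTail (n * n) (expPolyTaylor c μ) := by
  have h := hasDominatedTail_div_factorial (s := charRoots n μ) hM (fun z hz => ?_)
    (aeval_seqShift_expPolyDeriv c μ)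
  · rwa [card_charRoots] at h
  · obtain ⟨i, rfl⟩ := mem_range_of_mem_charRoots hz
    rw [card_charRoots]
    exact hμ i

/-- The coefficients of `t ↦ expPoly c lam (x₀ + ρ * t)`, as an exponential polynomial in `t` with
frequencies `lam i * ρ`. -/
noncomputable def affineCoeff (c : Fin n → Fin n → K) (lam : Fin n → K) (x₀ ρ : K)
    (i j : Fin n) : K :=
  exp (lam i * x₀) * ∑ l : Fin n, c i l * (l : ℕ).choose j * x₀ ^ (l - j : ℕ) * ρ ^ (j : ℕ)

theorem add_mul_pow_eq_sum_fin {R : Type*} [CommSemiring R] (x₀ ρ t : R) (l : Fin n) :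
    (x₀ + ρ * t) ^ (l : ℕ) =
      ∑ j : Fin n, (l : ℕ).choose j * x₀ ^ (l - j : ℕ) * ρ ^ (j : ℕ) * t ^ (j : ℕ) := by
  rw [Fin.sum_univ_eq_sum_range
      (fun j => (l : ℕ).choose j * x₀ ^ (l - j : ℕ) * ρ ^ j * t ^ j) n, add_comm x₀, add_pow]
  refine (Finset.sum_congr rfl fun j _ => by ring).trans <| Finset.sum_subset
    (Finset.range_mono l.2) fun j _ hj => ?_
  rw [Nat.choose_eq_zero_of_lt (by simpa using hj)]
  simp

theorem expPoly_add_mul (c : Fin n → Fin n → K) {lam : Fin n → K} {x₀ ρ t : K}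
    (hexp : ∀ i, exp (lam i * (x₀ + ρ * t)) = exp (lam i * x₀) * exp (lam i * ρ * t)) :
    expPoly c lam (x₀ + ρ * t) = expPoly (affineCoeff c lam x₀ ρ) (fun i => lam i * ρ) t := by
  unfold expPoly affineCoeff
  refine Finset.sum_congr rfl fun i _ => ?_
  simp only [hexp i, add_mul_pow_eq_sum_fin, Finset.mul_sum, Finset.sum_mul]
  rw [Finset.sum_comm]
  exact Finset.sum_congr rfl fun j _ => Finset.sum_congr rfl fun l _ => by ring

variable [NormedAlgebra 𝕜 K] [CharZero 𝕜] [CompleteSpace K]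

theorem hasSum_monomialExpDeriv {μ x : K} (hμ : μ * x ∈ eball (0 : K) (expSeries 𝕜 K).radius)
    (l : ℕ) :
    HasSum (fun m : ℕ => monomialExpDeriv μ l m / m ! * x ^ m) (x ^ l * exp (μ * x)) := by
  have : CharZero K := charZero_of_injective_algebraMap (algebraMap 𝕜 K).injective
  have hinit : ∑ m ∈ Finset.range l, monomialExpDeriv μ l m / m ! * x ^ m = 0 :=
    Finset.sum_eq_zero fun m hm => by
      simp [monomialExpDeriv, Nat.descFactorial_of_lt (Finset.mem_range.1 hm)]
  rw [← hasSum_nat_add_iff' l, hinit, sub_zero]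
  refine ((expSeries_div_hasSum_exp_of_mem_ball 𝕜 _ hμ).mul_left (x ^ l)).congr_fun fun k => ?_
  have hfac : (k ! : K) * (k + l).descFactorial l = (k + l)! := by
    have := Nat.factorial_mul_descFactorial (Nat.le_add_left l k)
    rw [Nat.add_sub_cancel] at this
    exact_mod_cast this
  have hk : (k ! : K) ≠ 0 := by exact_mod_cast k.factorial_ne_zero
  have hkl : ((k + l)! : K) ≠ 0 := by exact_mod_cast (k + l).factorial_ne_zero
  rw [monomialExpDeriv, Nat.add_sub_cancel, mul_pow, pow_add]
  field_simp
  rw [← hfac]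
  ring

theorem powerSum_expPolyTaylor (c : Fin n → Fin n → K) {μ : Fin n → K} {x : K}
    (hμ : ∀ i, μ i * x ∈ eball (0 : K) (expSeries 𝕜 K).radius) :
    powerSum (expPolyTaylor c μ) x = expPoly c μ x := by
  have hsum : HasSum
      (fun m => ∑ i, ∑ l : Fin n, c i l * (monomialExpDeriv (μ i) l m / m ! * x ^ m))
      (∑ i, ∑ l : Fin n, c i l * (x ^ (l : ℕ) * exp (μ i * x))) :=
    hasSum_sum fun i _ => hasSum_sum fun l _ => (hasSum_monomialExpDeriv (hμ i) l).mul_left _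
  simp only [← mul_assoc, mul_div_assoc'] at hsum
  simpa only [powerSum, expPolyTaylor, expPolyDeriv, expPoly, Finset.sum_apply, Pi.smul_apply,
    smul_eq_mul, Finset.sum_div, Finset.sum_mul] using hsum.tsum_eq

theorem expPoly_eq_powerSum (hM : FactorialInvBound 𝕜 M) (c : Fin n → Fin n → K)
    {lam : Fin n → K} {x₀ ρ t : K} (hx₀ : ∀ i, lam i * x₀ ∈ eball (0 : K) (expSeries 𝕜 K).radius)
    (hlam : ∀ i, ‖lam i * ρ‖ * M < 1) (ht : ‖t‖ ≤ 1) :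
    expPoly c lam (x₀ + ρ * t) =
      powerSum (expPolyTaylor (affineCoeff c lam x₀ ρ) fun i => lam i * ρ) t := by
  have hmem (i : Fin n) : lam i * ρ * t ∈ eball (0 : K) (expSeries 𝕜 K).radius := by
    refine hM.mem_eball_radius_expSeries (lt_of_le_of_lt ?_ (hlam i))
    have := hM.one_le
    rw [norm_mul _ t]
    gcongr
    exact mul_le_of_le_one_right (norm_nonneg _) ht
  rw [powerSum_expPolyTaylor _ hmem, expPoly_add_mul]
  intro i
  rw [mul_add, ← mul_assoc, exp_add_of_mem_ball (hx₀ i) (hmem i)]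

theorem norm_expPoly_le_of_separated (hM : FactorialInvBound 𝕜 M) (c : Fin n → Fin n → K)
    {lam : Fin n → K} {x₀ ρ x : K} {d ε : ℝ} (hρ : ρ ≠ 0)
    (hx₀ : ∀ i, lam i * x₀ ∈ eball (0 : K) (expSeries 𝕜 K).radius)
    (hlam : ∀ i, ‖lam i * ρ‖ ≤ frequencyRadius (n * n) M) (hd : 0 < d) (hd1 : d ≤ 1) (hε : 0 ≤ ε)
    {y : Fin (n * n) → K} (hy : ∀ i, y i ∈ closedBall x₀ ‖ρ‖)
    (hsep : Pairwise fun i j => d * ‖ρ‖ ≤ dist (y i) (y j)) (hf : ∀ i, ‖expPoly c lam (y i)‖ ≤ ε)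
    (hx : x ∈ closedBall x₀ ‖ρ‖) :
    ‖expPoly c lam x‖ ≤ 3 * 12 ^ (n * n) * ε / d ^ (n * n) := by
  have : CharZero K := charZero_of_injective_algebraMap (algebraMap 𝕜 K).injective
  have hρ0 : 0 < ‖ρ‖ := norm_pos_iff.2 hρ
  have hMK : FactorialInvBound K M := hM.of_algebra
  have hlamM (i : Fin n) : ‖lam i * ρ‖ * M < 1 :=
    (mul_le_mul_of_nonneg_right (hlam i) (zero_le_one.trans hM.one_le)).trans_lt
      (frequencyRadius_mul_lt_one _ hM.one_le)
  set a := expPolyTaylor (affineCoeff c lam x₀ ρ) fun i => lam i * ρ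
  have hnorm {z : K} (hz : z ∈ closedBall x₀ ‖ρ‖) : ‖(z - x₀) / ρ‖ ≤ 1 := by
    rw [norm_div, div_le_one hρ0, ← dist_eq_norm]
    exact hz
  have heq {z : K} (hz : z ∈ closedBall x₀ ‖ρ‖) :
      powerSum a ((z - x₀) / ρ) = expPoly c lam z := by
    rw [← expPoly_eq_powerSum hM c hx₀ hlamM (hnorm hz), mul_div_cancel₀ _ hρ,
      add_sub_cancel]
  rw [← heq hx]
  refine (hasDominatedTail_expPolyTaylor hMK _ hlam).norm_powerSum_le hd hd1 hε
    (fun i => hnorm (hy i)) (fun i j hij => ?_) (fun i => (heq (hy i)).symm ▸ hf i) (hnorm hx)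
  beta_reduce
  rw [← sub_div, sub_sub_sub_cancel_right, norm_div, le_div_iff₀ hρ0, ← dist_eq_norm]
  exact hsep hij

theorem continuousOn_expPoly (c : Fin n → Fin n → K) {lam : Fin n → K} {U : Set K}
    (hU : ∀ x ∈ U, ∀ i, lam i * x ∈ eball (0 : K) (expSeries 𝕜 K).radius) :
    ContinuousOn (expPoly c lam) U := by
  unfold expPoly
  refine continuousOn_finsetSum _ fun i _ => continuousOn_finsetSum _ fun l _ => .mul ?_ ?_
  · fun_prop
  · exact (continuousOn_exp (𝕂 := 𝕜)).comp (by fun_prop) fun x hx => hU x hx i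

end ExpPoly

section Sublevel

open Metric

variable {X : Type*} [PseudoMetricSpace X] [MeasurableSpace X] {μ : Measure X} {N : ℕ}

theorem exists_separated_of_mul_lt_measure {E : Set X} {r : ℝ} {b : ℝ≥0∞}
    (hb : ∀ x, μ (ball x r) ≤ b) (hE : N * b < μ E) :
    ∃ u : Fin N → X, (∀ i, u i ∈ E) ∧ Pairwise fun i j => r ≤ dist (u i) (u j) := by
  induction N with
  | zero => exact ⟨Fin.elim0, fun i => i.elim0, fun i => i.elim0⟩
  | succ N ih =>
    have hlt : N * b < μ E := lt_of_le_of_lt (by gcongr; exact N.le_succ) hE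
    obtain ⟨u, huE, hu⟩ := ih hlt
    have hcover : μ (⋃ i, ball (u i) r) ≤ N * b := by
      refine (measure_iUnion_fintype_le μ _).trans ?_
      simpa using Finset.sum_le_card_nsmul Finset.univ _ b fun i _ => hb (u i)
    obtain ⟨x, hxE, hx⟩ : ∃ x ∈ E, x ∉ ⋃ i, ball (u i) r := by
      by_contra! h
      exact (measure_mono (μ := μ) h).not_gt (hcover.trans_lt hlt)
    have hxu (i : Fin N) : r ≤ dist x (u i) := by
      simpa using fun h => hx (Set.mem_iUnion_of_mem i h)
    refine ⟨Fin.cons x u, Fin.cons hxE huE, pairwise_fin_succ_iff.2 ⟨fun i => ?_, hxu, hu⟩⟩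
    simpa [dist_comm] using hxu i

theorem exists_separated_of_measure_ne_zero {B E : Set X} {R : ℝ} (hEB : E ⊆ B) (hE : μ E ≠ 0)
    (hB : μ B ≠ ∞)
    (hball : ∀ x, ∀ d : ℝ, 0 < d → d ≤ 1 → μ (ball x (d * R)) ≤ ENNReal.ofReal d * μ B)
    (N : ℕ) :
    ∃ d : ℝ, 0 < d ∧ d ≤ 1 ∧ μ E = ENNReal.ofReal ((N + 1) * d) * μ B ∧
      ∃ u : Fin N → X, (∀ i, u i ∈ E) ∧ Pairwise fun i j => d * R ≤ dist (u i) (u j) := by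
  have hEle : μ E ≤ μ B := measure_mono hEB
  have hB0 : μ B ≠ 0 := fun h => hE (le_zero_iff.1 (h ▸ hEle))
  have hquot : μ E / μ B ≠ ∞ := ENNReal.div_ne_top (ne_top_of_le_ne_top hB hEle) hB0
  set t := (μ E / μ B).toReal
  have ht0 : 0 < t := ENNReal.toReal_pos (ENNReal.div_ne_zero.2 ⟨hE, hB⟩) hquot
  have ht1 : t ≤ 1 := ENNReal.toReal_le_of_le_ofReal zero_le_one <| by
    simpa using ENNReal.div_le_of_le_mul (by simpa using hEle)
  have hEt : μ E = ENNReal.ofReal t * μ B := by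
    rw [ENNReal.ofReal_toReal hquot, ENNReal.div_mul_cancel hB0 hB]
  have hd0 : 0 < t / (N + 1) := by positivity
  have hd1 : t / (N + 1) ≤ 1 :=
    div_le_one_of_le₀ (by linarith [N.cast_nonneg (α := ℝ)]) (by positivity)
  have hNd : (N + 1) * (t / (N + 1)) = t := mul_div_cancel₀ _ (by positivity)
  refine ⟨t / (N + 1), hd0, hd1, by rw [hNd, hEt],
    exists_separated_of_mul_lt_measure (fun x => hball x _ hd0 hd1) ?_⟩
  rw [hEt, ← mul_assoc]
  refine ENNReal.mul_lt_mul_left hB0 hB ?_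
  rw [← ENNReal.ofReal_natCast, ← ENNReal.ofReal_mul (by positivity)]
  exact (ENNReal.ofReal_lt_ofReal_iff ht0).2 (by linarith)

theorem measure_sublevel_le {F : Type*} [NormedField F] {B : Set X} {f : X → F}
    {ε R L α : ℝ} (hB : μ B ≠ ∞) (hε : 0 < ε) (hL : 0 < L) (hα : 0 ≤ α) (hαN : α * N ≤ 1)
    (hball : ∀ x, ∀ d : ℝ, 0 < d → d ≤ 1 → μ (ball x (d * R)) ≤ ENNReal.ofReal d * μ B)
    (hf : ∀ d : ℝ, 0 < d → d ≤ 1 → ∀ u : Fin N → X, (∀ i, u i ∈ B) →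
      (Pairwise fun i j => d * R ≤ dist (u i) (u j)) → (∀ i, ‖f (u i)‖ ≤ ε) →
      ∀ x ∈ B, ‖f x‖ ≤ L * ε / d ^ N) :
    μ {y ∈ B | ‖f y‖ < ε} ≤ ENNReal.ofReal ((N + 1) * L ^ α) *
      (ENNReal.ofReal ε / supNormOn μ B f) ^ α * μ B := by
  set E := {y ∈ B | ‖f y‖ < ε}
  rcases eq_or_ne (μ E) 0 with hE0 | hE0
  · rw [hE0]
    exact zero_le
  obtain ⟨d, hd0, hd1, hE, u, huE, hu⟩ :=
    exists_separated_of_measure_ne_zero (fun y hy => hy.1) hE0 hB hball N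
  set S := L * ε / d ^ N with hS
  have hS0 : 0 < S := by positivity
  have hsup : supNormOn μ B f ≤ ENNReal.ofReal S := iSup₂_le fun x hx => by
    rw [← ofReal_norm]
    exact ENNReal.ofReal_le_ofReal
      (hf d hd0 hd1 u (fun i => (huE i).1) hu (fun i => (huE i).2.le) x hx.1)
  have hd : d ≤ L ^ α * (ε / S) ^ α := by
    calc d = d ^ (1 : ℝ) := (Real.rpow_one d).symm
      _ ≤ d ^ (N * α) := Real.rpow_le_rpow_of_exponent_ge hd0 hd1 (by linarith)
      _ = (L * (ε / S)) ^ α := by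
        rw [Real.rpow_natCast_mul hd0.le]
        congr 1
        rw [hS]
        field_simp
      _ = L ^ α * (ε / S) ^ α := Real.mul_rpow hL.le (by positivity)
  calc μ E = ENNReal.ofReal ((N + 1) * d) * μ B := hE
    _ ≤ ENNReal.ofReal ((N + 1) * L ^ α * (ε / S) ^ α) * μ B := by
        rw [mul_assoc]
        gcongr
    _ = ENNReal.ofReal ((N + 1) * L ^ α) * (ENNReal.ofReal ε / ENNReal.ofReal S) ^ α * μ B := by
        rw [ENNReal.ofReal_mul (by positivity), ← ENNReal.ofReal_div_of_pos hS0,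
          ENNReal.ofReal_rpow_of_pos (by positivity)]
    _ ≤ _ := by gcongr

end Sublevel

section Good

open Metric NormedSpace

/-- The exponent `α` of the theorem. -/
noncomputable def goodExponent (n : ℕ) : ℝ :=
  1 / ((n * n : ℕ) + 1)

/-- The constant `C` of the theorem: `(N + 1) * L ^ α`, where `N = n * n` and `L` is the constant of
`norm_expPoly_le_of_separated`. -/
noncomputable def goodConst (n : ℕ) : ℝ :=
  ((n * n : ℕ) + 1) * (3 * 12 ^ (n * n)) ^ goodExponent n

theorem goodExponent_pos (n : ℕ) : 0 < goodExponent n := by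
  unfold goodExponent
  positivity

theorem goodExponent_mul_le_one (n : ℕ) : goodExponent n * (n * n : ℕ) ≤ 1 := by
  rw [goodExponent, one_div_mul_eq_div]
  exact div_le_one_of_le₀ (by linarith) (by positivity)

theorem goodConst_pos (n : ℕ) : 0 < goodConst n := by
  unfold goodConst
  positivity

theorem measure_expPoly_sublevel_le {𝕜 K : Type*} [NontriviallyNormedField 𝕜] [CharZero 𝕜]
    [MeasurableSpace 𝕜] [NormedField K] [NormedAlgebra 𝕜 K] [CompleteSpace K] {n : ℕ} {M : ℝ}
    (hM : FactorialInvBound 𝕜 M) (c : Fin n → Fin n → K) {lam : Fin n → K} {x₀ ρ : 𝕜} (hρ : ρ ≠ 0)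
    (hx₀ : ∀ i, lam i * algebraMap 𝕜 K x₀ ∈ eball (0 : K) (expSeries 𝕜 K).radius)
    (hlam : ∀ i, ‖lam i‖ * ‖ρ‖ ≤ frequencyRadius (n * n) M) {μ : Measure 𝕜} {B : Set 𝕜}
    (hBρ : B ⊆ closedBall x₀ ‖ρ‖) (hB : μ B ≠ ∞)
    (hball : ∀ x, ∀ d : ℝ, 0 < d → d ≤ 1 → μ (ball x (d * ‖ρ‖)) ≤ ENNReal.ofReal d * μ B)
    {ε : ℝ} (hε : 0 < ε) :
    μ {y ∈ B | ‖expPoly c lam (algebraMap 𝕜 K y)‖ < ε} ≤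
      ENNReal.ofReal (goodConst n) *
        (ENNReal.ofReal ε / supNormOn μ B fun s => expPoly c lam (algebraMap 𝕜 K s)) ^
          goodExponent n * μ B := by
  have hdist := (algebraMap_isometry 𝕜 K).dist_eq
  have hmem {z : 𝕜} (hz : z ∈ B) : algebraMap 𝕜 K z ∈ closedBall (algebraMap 𝕜 K x₀) ‖ρ‖ := by
    rw [mem_closedBall, hdist]
    exact hBρ hz
  refine measure_sublevel_le hB hε (by positivity) (goodExponent_pos n).le
    (goodExponent_mul_le_one n) hball fun d hd hd1 u hu hsep hfu x hx => ?_
  rw [← norm_algebraMap' K ρ] at hlam hmem hsep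
  exact norm_expPoly_le_of_separated hM c (by simpa using hρ) hx₀
    (fun i => (norm_mul _ _).trans_le (hlam i)) hd hd1 hε.le (fun i => hmem (hu i))
    (fun i j hij => (hsep hij).trans_eq (hdist _ _).symm) hfu (hmem hx)

theorem factorialInvBound_real : FactorialInvBound ℝ 1 := fun m => by
  rw [one_pow, norm_inv, Real.norm_natCast]
  exact inv_le_one_of_one_le₀ (by exact_mod_cast m.factorial_pos)

theorem isGoodOn_expPoly_real {n : ℕ} {Λ : ℝ} (hΛ : 0 < Λ) (c : Fin n → Fin n → ℂ)
    {lam : Fin n → ℂ} (hlam : ∀ i, ‖lam i‖ ≤ Λ) {I : Set ℝ}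
    (hI : volume I ≤ ENNReal.ofReal (frequencyRadius (n * n) 1 / Λ)) :
    IsGoodOn (goodConst n) (goodExponent n) volume I fun s : ℝ => expPoly c lam (s : ℂ) := by
  have hη : 0 < frequencyRadius (n * n) 1 := frequencyRadius_pos _ le_rfl
  have hexp (z : ℂ) : z ∈ eball (0 : ℂ) (expSeries ℝ ℂ).radius :=
    (expSeries_radius_eq_top ℝ ℂ).symm ▸ edist_lt_top _ _
  refine ⟨(continuousOn_expPoly c fun x _ i => hexp _).comp Complex.continuous_ofReal.continuousOn
    (Set.mapsTo_univ _ _), fun x _ r hr hball ε hε => ?_⟩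
  have hrI : r ≤ frequencyRadius (n * n) 1 / Λ := by
    have h := (measure_mono hball).trans hI
    rw [Real.volume_ball, ENNReal.ofReal_le_ofReal_iff (by positivity)] at h
    linarith
  refine measure_expPoly_sublevel_le factorialInvBound_real c (x₀ := x) hr.ne' (fun i => hexp _)
    (fun i => ?_) ?_ measure_ball_lt_top.ne (fun z d hd _ => ?_) hε
  all_goals rw [Real.norm_of_nonneg hr.le]
  · calc ‖lam i‖ * r ≤ Λ * (frequencyRadius (n * n) 1 / Λ) := by
          gcongr
          exact hlam i
      _ = frequencyRadius (n * n) 1 := mul_div_cancel₀ _ hΛ.ne'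
  · exact ball_subset_closedBall
  · rw [Real.volume_ball, Real.volume_ball, ← ENNReal.ofReal_mul hd.le, mul_left_comm]

variable {p : ℕ} [hp : Fact p.Prime]

theorem factorialInvBound_padic : FactorialInvBound ℚ_[p] p := fun m => by
  have hp1 : (1 : ℝ) ≤ p := by exact_mod_cast hp.out.one_lt.le
  rw [norm_inv, Padic.norm_eq_zpow_neg_valuation (by exact_mod_cast m.factorial_ne_zero),
    Padic.valuation_natCast, zpow_neg, inv_inv, zpow_natCast]
  exact pow_le_pow_right₀ hp1 (padicValNat_factorial_le p m)

theorem norm_le_of_mem_primePowIntegers {F : Type*} [NormedField F] [NormedAlgebra ℚ_[p] F]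
    {k : ℕ} {x : F} (hx : x ∈ primePowIntegers F p k) : ‖x‖ ≤ (p : ℝ)⁻¹ ^ k := by
  obtain ⟨y, hy, rfl⟩ := hx
  rw [← map_natCast (algebraMap ℚ_[p] F), ← map_pow, norm_mul, norm_algebraMap', norm_pow,
    Padic.norm_p]
  exact mul_le_of_le_one_right (by positivity) hy

theorem exists_ball_padic_eq_closedBall (x : ℚ_[p]) {r : ℝ} (hr : 0 < r) :
    ∃ ρ : ℚ_[p], ρ ≠ 0 ∧ ball x r = closedBall x ‖ρ‖ := by
  obtain ⟨l, hl, hl'⟩ := exists_mem_Ioc_zpow hr (y := (p : ℝ)) (by exact_mod_cast hp.out.one_lt)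
  have hρ : ‖(p : ℚ_[p]) ^ (-l)‖ = (p : ℝ) ^ l := by rw [Padic.norm_p_zpow, neg_neg]
  refine ⟨(p : ℚ_[p]) ^ (-l), zpow_ne_zero _ (by exact_mod_cast hp.out.ne_zero), ?_⟩
  ext z
  rw [mem_ball, mem_closedBall, hρ, dist_eq_norm]
  exact ⟨fun h => (Padic.norm_le_pow_iff_norm_lt_pow_add_one _ _).2 (h.trans_le hl'),
    fun h => h.trans_lt hl⟩

theorem zpow_neg_lt_norm_natCast_sub_natCast {i j j' : ℕ} (hj : j < p ^ i) (hj' : j' < p ^ i)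
    (hne : j ≠ j') : (p : ℝ) ^ (-i : ℤ) < ‖(j - j' : ℚ_[p])‖ := by
  by_contra! h
  have hdvd := (Padic.norm_int_le_pow_iff_dvd (p := p) (j - j' : ℤ) i).1 (by exact_mod_cast h)
  have hlt : |(j - j' : ℤ)| < (p ^ i : ℕ) := by
    rw [abs_lt]
    constructor <;> lia
  have := Int.eq_zero_of_abs_lt_dvd hdvd (by exact_mod_cast hlt)
  lia

theorem pairwise_disjoint_closedBall_add_mul_natCast (x₀ : ℚ_[p]) {ρ : ℚ_[p]} (hρ : ρ ≠ 0)
    (i : ℕ) :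
    Pairwise (Function.onFun Disjoint fun j : Fin (p ^ i) =>
      closedBall (x₀ + ρ * (j : ℕ)) (‖ρ‖ * (p : ℝ) ^ (-i : ℤ))) := by
  intro j j' hne
  refine (IsUltrametricDist.closedBall_eq_or_disjoint _ _ _).resolve_left fun heq => ?_
  have hmem : x₀ + ρ * (j : ℕ) ∈
      closedBall (x₀ + ρ * (j' : ℕ)) (‖ρ‖ * (p : ℝ) ^ (-i : ℤ)) :=
    heq ▸ mem_closedBall_self (by positivity)
  rw [mem_closedBall, dist_eq_norm, add_sub_add_left_eq_sub, ← mul_sub, norm_mul,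
    mul_le_mul_iff_right₀ (norm_pos_iff.2 hρ)] at hmem
  exact hmem.not_gt (zpow_neg_lt_norm_natCast_sub_natCast j.2 j'.2 (Fin.val_injective.ne hne))

theorem closedBall_add_mul_natCast_subset (x₀ ρ : ℚ_[p]) {s : ℝ} (hs : s ≤ ‖ρ‖) (j : ℕ) :
    closedBall (x₀ + ρ * j) s ⊆ closedBall x₀ ‖ρ‖ := by
  have hmem : x₀ + ρ * j ∈ closedBall x₀ ‖ρ‖ := by
    rw [mem_closedBall, dist_eq_norm, add_sub_cancel_left, norm_mul]
    exact mul_le_of_le_one_right (norm_nonneg _) (by exact_mod_cast Padic.norm_int_le_one j)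
  rw [IsUltrametricDist.closedBall_eq_of_mem hmem]
  exact closedBall_subset_closedBall hs

theorem norm_le_one_of_closedBall_subset_padicInt {x₀ ρ : ℚ_[p]}
    (h : closedBall x₀ ‖ρ‖ ⊆ PadicInt.subring p) : ‖ρ‖ ≤ 1 := by
  have hx₀ : x₀ ∈ PadicInt.subring p := h (mem_closedBall_self (norm_nonneg _))
  have hx₀ρ : x₀ + ρ ∈ PadicInt.subring p := h (by simp)
  simpa using sub_mem hx₀ρ hx₀

theorem mul_algebraMap_mem_eball_radius_expSeries {F : Type*} [NormedField F]
    [NormedAlgebra ℚ_[p] F] {N : ℕ} {z : F} (hz : ‖z‖ ≤ frequencyRadius N p) {s : ℚ_[p]}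
    (hs : s ∈ PadicInt.subring p) :
    z * algebraMap ℚ_[p] F s ∈ eball (0 : F) (expSeries ℚ_[p] F).radius := by
  have hM : FactorialInvBound ℚ_[p] p := factorialInvBound_padic
  refine hM.mem_eball_radius_expSeries (lt_of_le_of_lt ?_ (frequencyRadius_mul_lt_one N hM.one_le))
  rw [norm_mul, norm_algebraMap']
  gcongr
  exact (mul_le_of_le_one_right (norm_nonneg _) hs).trans hz

variable [MeasurableSpace ℚ_[p]] [BorelSpace ℚ_[p]] (μ : Measure ℚ_[p]) [μ.IsAddHaarMeasure]

theorem pow_mul_measure_closedBall_le (x x₀ : ℚ_[p]) {ρ : ℚ_[p]} (hρ : ρ ≠ 0) (i : ℕ) :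
    (p : ℝ≥0∞) ^ i * μ (closedBall x (‖ρ‖ * (p : ℝ) ^ (-i : ℤ))) ≤ μ (closedBall x₀ ‖ρ‖) := by
  have hp1 : (1 : ℝ) ≤ p := by exact_mod_cast hp.out.one_lt.le
  set s := ‖ρ‖ * (p : ℝ) ^ (-i : ℤ)
  have hs : s ≤ ‖ρ‖ :=
    mul_le_of_le_one_right (norm_nonneg _) (zpow_le_one_of_nonpos₀ hp1 (by simp))
  calc (p : ℝ≥0∞) ^ i * μ (closedBall x s)
      = ∑ j : Fin (p ^ i), μ (closedBall (x₀ + ρ * (j : ℕ)) s) := by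
        simp [Measure.addHaar_closedBall_center]
    _ = μ (⋃ j : Fin (p ^ i), closedBall (x₀ + ρ * (j : ℕ)) s) := by
        rw [measure_iUnion (pairwise_disjoint_closedBall_add_mul_natCast x₀ hρ i) fun _ =>
          measurableSet_closedBall, tsum_fintype]
    _ ≤ μ (closedBall x₀ ‖ρ‖) := by
        gcongr
        exact Set.iUnion_subset fun j => closedBall_add_mul_natCast_subset x₀ ρ hs j

theorem measure_ball_padic_le (x x₀ : ℚ_[p]) {ρ : ℚ_[p]} (hρ : ρ ≠ 0) {d : ℝ} (hd : 0 < d)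
    (hd1 : d ≤ 1) :
    μ (ball x (d * ‖ρ‖)) ≤ ENNReal.ofReal d * μ (closedBall x₀ ‖ρ‖) := by
  have hp0 : (0 : ℝ) < p := by exact_mod_cast hp.out.pos
  obtain ⟨i, hi, hi'⟩ : ∃ i : ℕ, (p : ℝ)⁻¹ ^ (i + 1) < d ∧ d ≤ (p : ℝ)⁻¹ ^ i :=
    exists_nat_pow_near_of_lt_one hd hd1 (by positivity)
      (inv_lt_one_of_one_lt₀ (by exact_mod_cast hp.out.one_lt))
  have hsub : ball x (d * ‖ρ‖) ⊆ closedBall x (‖ρ‖ * (p : ℝ) ^ (-(i + 1 : ℕ) : ℤ)) := by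
    intro z hz
    rw [mem_ball, dist_eq_norm, ← div_lt_iff₀ (norm_pos_iff.2 hρ), ← norm_div] at hz
    rw [mem_closedBall, dist_eq_norm, mul_comm, ← div_le_iff₀ (norm_pos_iff.2 hρ), ← norm_div,
      Padic.norm_le_pow_iff_norm_lt_pow_add_one]
    simpa using hz.trans_le hi'
  have hd' : ((p : ℝ≥0∞) ^ (i + 1))⁻¹ ≤ ENNReal.ofReal d := by
    rw [ENNReal.inv_pow, ← ENNReal.ofReal_natCast, ← ENNReal.ofReal_inv_of_pos hp0,
      ← ENNReal.ofReal_pow (by positivity)]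
    exact ENNReal.ofReal_le_ofReal hi.le
  calc μ (ball x (d * ‖ρ‖)) ≤ μ (closedBall x (‖ρ‖ * (p : ℝ) ^ (-(i + 1 : ℕ) : ℤ))) :=
        measure_mono hsub
    _ ≤ ((p : ℝ≥0∞) ^ (i + 1))⁻¹ * μ (closedBall x₀ ‖ρ‖) := by
        rw [← ENNReal.mul_le_iff_le_inv (by simp [hp.out.ne_zero]) (by finiteness)]
        exact pow_mul_measure_closedBall_le μ x x₀ hρ (i + 1)
    _ ≤ ENNReal.ofReal d * μ (closedBall x₀ ‖ρ‖) := by gcongr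

theorem isGoodOn_expPoly_padic {F : Type*} [NormedField F] [NormedAlgebra ℚ_[p] F]
    [CompleteSpace F] {n : ℕ} (c : Fin n → Fin n → F) {lam : Fin n → F}
    (hlam : ∀ i, ‖lam i‖ ≤ frequencyRadius (n * n) p) :
    IsGoodOn (goodConst n) (goodExponent n) μ (PadicInt.subring p : Set ℚ_[p]) fun s =>
      expPoly c lam (algebraMap ℚ_[p] F s) := by
  have hexp {s : ℚ_[p]} (hs : s ∈ PadicInt.subring p) (i : Fin n) :=
    mul_algebraMap_mem_eball_radius_expSeries (hlam i) hs
  refine ⟨(continuousOn_expPoly c (Set.forall_mem_image.2 fun s hs i => hexp hs i)).comp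
    (continuous_algebraMap ℚ_[p] F).continuousOn (Set.mapsTo_image _ _),
    fun x₀ _ r hr hball ε hε => ?_⟩
  have hfin : μ (ball x₀ r) ≠ ∞ := measure_ball_lt_top.ne
  obtain ⟨ρ, hρ, hBρ⟩ := exists_ball_padic_eq_closedBall x₀ hr
  rw [hBρ] at hball hfin ⊢
  have hρ1 : ‖ρ‖ ≤ 1 := norm_le_one_of_closedBall_subset_padicInt hball
  exact measure_expPoly_sublevel_le factorialInvBound_padic c hρ
    (hexp (hball (mem_closedBall_self (norm_nonneg _))))
    (fun i => (mul_le_of_le_one_right (norm_nonneg _) hρ1).trans (hlam i)) subset_rfl hfin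
    (fun x d hd hd1 => measure_ball_padic_le μ x x₀ hρ hd hd1) hε

end Good

theorem proposition2p2_general (n : ℕ) :
    ∃ C > 0, ∃ α > 0,
      (∀ Λ : ℝ, 0 < Λ → ∃ δ₀ > 0,
        ∀ (c : Fin n → Fin n → ℂ) (lam : Fin n → ℂ), (∀ i, ‖lam i‖ ≤ Λ) →
        ∀ I : Set ℝ, volume I ≤ ENNReal.ofReal δ₀ →
          IsGoodOn C α volume I (fun s : ℝ => expPoly c lam (s : ℂ))) ∧
      (∀ (p : ℕ) [Fact p.Prime], ∃ k : ℕ,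
        ∀ (F : Type*) [NormedField F] [NormedAlgebra ℚ_[p] F] [CompleteSpace F],
          (∀ x ∈ primePowIntegers F p k, ∀ s ∈ (PadicInt.subring p : Set ℚ_[p]),
            Summable fun m : ℕ => (x * algebraMap ℚ_[p] F s) ^ m / (m.factorial : F)) ∧
          ∀ (c : Fin n → Fin n → F) (lam : Fin n → F),
            (∀ i, lam i ∈ primePowIntegers F p k) →
            ∀ [MeasurableSpace ℚ_[p]] [BorelSpace ℚ_[p]] (μ : Measure ℚ_[p])
              [μ.IsAddHaarMeasure],
              IsGoodOn C α μ (PadicInt.subring p : Set ℚ_[p])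
                (fun s : ℚ_[p] => expPoly c lam (algebraMap ℚ_[p] F s))) := by
  refine ⟨goodConst n, goodConst_pos n, goodExponent n, goodExponent_pos n,
    fun Λ hΛ => ⟨_, div_pos (frequencyRadius_pos (n * n) le_rfl) hΛ,
      fun c lam hlam I hI => isGoodOn_expPoly_real hΛ c hlam hI⟩, fun p hp => ?_⟩
  obtain ⟨k, hk⟩ : ∃ k : ℕ, (p : ℝ)⁻¹ ^ k < frequencyRadius (n * n) p :=
    exists_pow_lt_of_lt_one (frequencyRadius_pos _ (factorialInvBound_padic (p := p)).one_le)
      (inv_lt_one_of_one_lt₀ (by exact_mod_cast hp.out.one_lt))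
  refine ⟨k, fun F _ _ _ => ?_⟩
  have hle {x : F} (hx : x ∈ primePowIntegers F p k) : ‖x‖ ≤ frequencyRadius (n * n) p :=
    (norm_le_of_mem_primePowIntegers hx).trans hk.le
  exact ⟨fun x hx s hs => NormedSpace.expSeries_div_summable_of_mem_ball ℚ_[p] _
    (mul_algebraMap_mem_eball_radius_expSeries (hle hx) hs),
    fun c lam hlam _ _ μ _ => isGoodOn_expPoly_padic μ c fun i => hle (hlam i)⟩

theorem proposition2p2 (n : ℕ) :
    -- Archimedean case
    (∃ C > 0, ∃ α > 0, ∀ Λ : ℝ, 0 < Λ → ∃ δ₀ > 0,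
      ∀ (c : Fin n → Fin n → ℂ) (lam : Fin n → ℂ), (∀ i, ‖lam i‖ ≤ Λ) →
      ∀ I : Set ℝ, I.OrdConnected → volume I ≤ ENNReal.ofReal δ₀ →
        IsGoodOn C α volume I (fun s : ℝ => expPoly c lam (s : ℂ))) ∧
    -- non-Archimedean case
    (∀ (p : ℕ) [Fact p.Prime] (F : Type*) [NormedField F] [NormedAlgebra ℚ_[p] F]
      [FiniteDimensional ℚ_[p] F],
      ∃ k : ℕ,
        -- the exponentials `e^{λ s}` make sense
        (∀ x ∈ primePowIntegers F p k, ∀ s ∈ (PadicInt.subring p : Set ℚ_[p]),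
          Summable fun m : ℕ => (x * algebraMap ℚ_[p] F s) ^ m / (m.factorial : F)) ∧
        ∃ C > 0, ∃ α > 0,
          ∀ (c : Fin n → Fin n → F) (lam : Fin n → F), Function.Injective lam →
          (∀ i, lam i ∈ primePowIntegers F p k) →
          ∀ [MeasurableSpace ℚ_[p]] [BorelSpace ℚ_[p]] (μ : Measure ℚ_[p])
            [μ.IsAddHaarMeasure], μ (PadicInt.subring p : Set ℚ_[p]) = 1 →
            IsGoodOn C α μ (PadicInt.subring p : Set ℚ_[p])
              (fun s : ℚ_[p] => expPoly c lam (algebraMap ℚ_[p] F s))) := by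
  obtain ⟨C, hC, α, hα, hreal, hpadic⟩ := proposition2p2_general n
  refine ⟨⟨C, hC, α, hα, fun Λ hΛ => ?_⟩, fun p _ F _ _ _ => ?_⟩
  · obtain ⟨δ₀, hδ₀, h⟩ := hreal Λ hΛ
    exact ⟨δ₀, hδ₀, fun c lam hlam I _ => h c lam hlam I⟩
  · have := FiniteDimensional.complete ℚ_[p] F
    obtain ⟨k, hk⟩ := hpadic p
    obtain ⟨hsum, hgood⟩ := hk F
    exact ⟨k, hsum, C, hC, α, hα, fun c lam _ hlam _ _ μ _ _ => hgood c lam hlam μ⟩
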